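/- Let $R$ and $C$ be finite-dimensional quantum registers with $|C|=d$, let $\{|c\rangle\}_{c=0}^{d-1}$ be any orthonormal basis of $\mathcal H_C$, and let $Q$ be a qubit. Let $g$ be a prime with $d^2\le g\le 2d^2$, and let $\mathcal H_G\subseteq\mathcal H_Q\otimes\mathcal H_C\otimes\mathcal H_C$ be the $g$-dimensional subspace with orthonormal basis $\{|i\rangle\}_{i=0}^{g-1}$, where $|q d^2+c d+c'\rangle:=|q\rangle|c\rangle|c'\rangle$ for $q\in\{0,1\}$, $c,c'\in\{0,\dots,d-1\}$ with $q d^2+c d+c'\le g-1$. Let $C_0,C_1$ be copies of $C$ and $G_1,G_2$ copies of $G$, with $\mathcal H_{G_1}\subseteq\mathcal H_Q\otimes\mathcal H_{C_0}\otimes\mathcal H_{C_1}$. For $\ell\in\{0,\dots,g-1\}$ put $$U_\ell:=\sum_{i,j=0}^{g-1}|i+(j-i)\ell\rangle_{G_1}|j+(j-i)\ell\rangle_{G_2}\langle i|_{G_1}\langle j|_{G_2},$$ with arithmetic in the kets modulo $g$. Write $\mu_A=\mathrm{I}_A/|A|$ for the maximally mixed state. Let $\Psi_{RC}$ be a quantum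 state with marginal $\Psi_R=\mathrm{Tr}_C\Psi_{RC}$, let $S\subseteq\{0,\dots,g-1\}$ be non-empty, $N=|S|$, and $$\tau_{RG_1G_2}:=\frac1N\sum_{\ell\in S}U_\ell\left(\Psi_{RC_0}\otimes|0\rangle\langle0|_Q\otimes\mu_{C_1}\otimes\mu_{G_2}\right)U_\ell^\dagger .$$ Then $\tau$ is a quantum state, $k:=D_{\max}(\Psi_{RC}\,\|\,\Psi_R\otimes\mu_C)=\inf\{\lambda\in\mathbb R:\Psi_{RC}\preceq2^\lambda\,\Psi_R\otimes\mu_C\}$ is finite, and $$D(\tau_{RG_1G_2}\,\|\,\Psi_R\otimes\mu_{G_1}\otimes\mu_{G_2})\le\log_2\left(1+\frac{2^{k+1}-1}{N}\right),\qquad F^2(\tau_{RG_1G_2},\Psi_R\otimes\mu_{G_1}\otimes\mu_{G_2})\ge\frac{1}{1+\frac{2^{k+1}-1}{N}} .$$ Here $D(\rho\|\sigma)=\mathrm{Tr}\,\rho(\log_2\rho-\log_2\sigma)$ if $\mathrm{supp}\,\rho\subseteq\mathrm{supp}\,\sigma$ and $+\infty$ otherwise, $F(\rho,\sigma)=\|\sqrt\rho\sqrt\sigma\|_1$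 with $\|X\|_1=\mathrm{Tr}\sqrt{X^\dagger X}$, and $\preceq$ is the Löwner order. -/

import Mathlib

open scoped Kronecker ComplexOrder

namespace ConvexSplit

noncomputable section

variable {m n : Type*} [Fintype m] [DecidableEq m] [Fintype n] [DecidableEq n]

/-- A quantum state (density matrix) on the register with orthonormal basis `n`. -/
def IsState (ρ : Matrix n n ℂ) : Prop :=
  ρ.PosSemidef ∧ ρ.trace = 1

/-- The maximally mixed state `μ = 1 / dim`. -/
def maxMixed (n : Type*) [Fintype n] [DecidableEq n] : Matrix n n ℂ :=
  ((Fintype.card n : ℂ)⁻¹) • (1 : Matrix n n ℂ)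

/-- The marginal on the first register: the partial trace over the second register. -/
def marginalLeft (ρ : Matrix (m × n) (m × n) ℂ) : Matrix m m ℂ :=
  Matrix.of fun a b => ∑ c : n, ρ (a, c) (b, c)

/-- The trace norm `‖X‖₁ = Tr √(X† X)`. -/
def traceNorm (X : Matrix n n ℂ) : ℝ :=
  (cfc Real.sqrt (X.conjTranspose * X)).trace.re

/-- The fidelity `F(ρ, σ) = ‖√ρ √σ‖₁`. -/
def fidelity (ρ σ : Matrix n n ℂ) : ℝ :=
  traceNorm (cfc Real.sqrt ρ * cfc Real.sqrt σ)

/-- The max-relative entropy: the least real `l` with `ρ ≤ 2 ^ l • σ` in the Löwner order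
(`⊤` if there is none). -/
def dMax (ρ σ : Matrix n n ℂ) : EReal :=
  ⨅ (l : ℝ) (_ : (((2 : ℝ) ^ l) • σ - ρ).PosSemidef), (l : EReal)

open Classical in
/-- The (Umegaki) quantum relative entropy `D(ρ ‖ σ) = Tr ρ (log₂ ρ - log₂ σ)`, equal to `⊤` unless
the support of `ρ` lies in that of `σ`. For Hermitian matrices, whose support is the orthogonal
complement of the kernel, the latter means `ker σ ⊆ ker ρ`. The value given to `log₂ 0` by the
functional calculus is then immaterial. -/
def relEntropy (ρ σ : Matrix n n ℂ) : EReal :=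
  if ∀ v : n → ℂ, σ.mulVec v = 0 → ρ.mulVec v = 0 then
    (((ρ * (cfc (Real.logb 2) ρ - cfc (Real.logb 2) σ)).trace.re : ℝ) : EReal)
  else ⊤

/-- The inclusion of the basis `{|i⟩}` of `G`, `|G| = g ≤ 2 d²`, into the product basis of
`Q ⊗ C ⊗ C`, `|Q| = 2`, `|C| = d`: it is the inverse of the labelling
`|q⟩|c⟩|c'⟩ ↦ |q d² + c d + c'⟩`. -/
def basisG {d g : ℕ} [NeZero g] (h : g ≤ 2 * (d * d)) (i : ZMod g) : Fin 2 × Fin d × Fin d :=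
  let x := finProdFinEquiv.symm (Fin.castLE h ⟨i.val, ZMod.val_lt i⟩)
  (x.1, finProdFinEquiv.symm x.2)

theorem basisG_label {d g : ℕ} [NeZero g] (h : g ≤ 2 * (d * d)) (i : ZMod g) :
    ((basisG h i).1 : ℕ) * (d * d) + ((basisG h i).2.1 : ℕ) * d + ((basisG h i).2.2 : ℕ)
      = i.val := by
  have h2 : ((finProdFinEquiv (finProdFinEquiv.symm
      (Fin.castLE h ⟨i.val, ZMod.val_lt i⟩)) : Fin (2 * (d * d))) : ℕ) = i.val := by
    rw [Equiv.apply_symm_apply]; rfl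
  rw [finProdFinEquiv_apply_val] at h2
  have h3 := congrArg Fin.val (finProdFinEquiv.apply_symm_apply
    (finProdFinEquiv.symm (Fin.castLE h ⟨i.val, ZMod.val_lt i⟩)).2)
  rw [finProdFinEquiv_apply_val] at h3
  simp only [basisG]
  linear_combination h2 + h3

/-- The projector `|0⟩⟨0|` on the qubit `Q`. -/
def ketbraZero : Matrix (Fin 2) (Fin 2) ℂ := Matrix.single 0 0 1

/-- The state `Ψ_{RC₀} ⊗ |0⟩⟨0|_Q ⊗ μ_{C₁}` regarded as an operator on `R ⊗ G₁`, through the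
inclusion `G₁ ⊆ Q ⊗ C₀ ⊗ C₁`. -/
def stateRG {R : Type*} {d g : ℕ} [NeZero g] (h : g ≤ 2 * (d * d))
    (Ψ : Matrix (R × Fin d) (R × Fin d) ℂ) : Matrix (R × ZMod g) (R × ZMod g) ℂ :=
  ((Ψ ⊗ₖ ketbraZero) ⊗ₖ maxMixed (Fin d)).submatrix
    (fun x => (((x.1, (basisG h x.2).2.1), (basisG h x.2).1), (basisG h x.2).2.2))
    (fun x => (((x.1, (basisG h x.2).2.1), (basisG h x.2).1), (basisG h x.2).2.2))

/-- `U_ℓ = ∑_{i,j} |i + (j - i) ℓ⟩|j + (j - i) ℓ⟩⟨i|⟨j|` on `G₁ ⊗ G₂`, arithmetic modulo `g`. -/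
def U {g : ℕ} [NeZero g] (l : ZMod g) : Matrix (ZMod g × ZMod g) (ZMod g × ZMod g) ℂ :=
  ∑ i : ZMod g, ∑ j : ZMod g,
    Matrix.single (i + (j - i) * l, j + (j - i) * l) (i, j) (1 : ℂ)

/-- `τ_ℓ = U_ℓ (Ψ_{RC₀} ⊗ |0⟩⟨0|_Q ⊗ μ_{C₁} ⊗ μ_{G₂}) U_ℓ†` on `R ⊗ (G₁ ⊗ G₂)`. -/
def tauOne {R : Type*} [Fintype R] [DecidableEq R] {d g : ℕ} [NeZero g] (h : g ≤ 2 * (d * d))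
    (Ψ : Matrix (R × Fin d) (R × Fin d) ℂ) (l : ZMod g) :
    Matrix (R × ZMod g × ZMod g) (R × ZMod g × ZMod g) ℂ :=
  ((1 : Matrix R R ℂ) ⊗ₖ U l) *
    Matrix.reindex (Equiv.prodAssoc R (ZMod g) (ZMod g)) (Equiv.prodAssoc R (ZMod g) (ZMod g))
      (stateRG h Ψ ⊗ₖ maxMixed (ZMod g)) *
    ((1 : Matrix R R ℂ) ⊗ₖ U l).conjTranspose

/-- `τ = (1 / |S|) ∑_{ℓ ∈ S} τ_ℓ`. -/
def tau {R : Type*} [Fintype R] [DecidableEq R] {d g : ℕ} [NeZero g] (h : g ≤ 2 * (d * d))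
    (Ψ : Matrix (R × Fin d) (R × Fin d) ℂ) (S : Finset (ZMod g)) :
    Matrix (R × ZMod g × ZMod g) (R × ZMod g × ZMod g) ℂ :=
  ((S.card : ℂ)⁻¹) • ∑ l ∈ S, tauOne h Ψ l

end

end ConvexSplit

/-!
The relative entropy and the fidelity are both controlled by a single quadratic quantity, so that
neither operator monotonicity of the logarithm nor the data processing inequality is needed.

Write `σ` for `Ψ_{RC₀} ⊗ |0⟩⟨0| ⊗ μ_{C₁}` on `R ⊗ G₁` and `ω = Ψ_R ⊗ μ ⊗ μ`. If `ω X = τ`, then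
`Q = Re Tr(τ X)` is the Petz quantity `Tr(τ² ω⁻¹)` of order `2`. In eigenbases of `τ` and `ω`, with
eigenvalues `p_a`, `q_b` and squared overlaps `w_ab`, the numbers `p_a w_ab` are a probability
distribution, and `D(τ ‖ ω)`, `Q`, `Tr √τ √ω` are its averages of `log (p_a / q_b)`, `p_a / q_b`,
`(p_a / q_b)^(-1/2)`. Jensen's inequality gives `D ≤ log Q` and `(Tr √τ √ω)² ≥ 1 / Q`, and
`F ≥ Tr √τ √ω` (`relEntropy_le_and_le_fidelity`).

It remains to show `Q ≤ 1 + (2^(k+1) - 1) / N`. As the inclusion of `G` costs a factor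
`g / d² ≤ 2`, the definition of `k` gives `σ ≤ 2^(k+1) Ψ_R ⊗ μ` (`posSemidef_smul_sub_stateRG`),
so there is `Y` with `(Ψ_R ⊗ μ) Y = σ` and `Re Tr(σ Y) ≤ 2^(k+1)` (`exists_factor_of_le`). Each
`U_ℓ` permutes the basis and commutes with `ω`, hence `X = N⁻¹ ∑_ℓ U_ℓ (Y ⊗ 1) U_ℓ†` solves
`ω X = τ`. Expanding `Tr(τ X)` into `N²` terms, the `N` diagonal ones are `Tr(σ Y)`. The others are
`1`: `U_{ℓ'}† U_ℓ = U_{ℓ - ℓ'}`, and for `m ≠ 0` the marginal of `U_m (σ ⊗ μ) U_m†` on `R ⊗ G₁` is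
`Ψ_R ⊗ μ`, as multiplication by `m` is a bijection modulo the prime `g` (`trace_shear_mul`).
-/

open scoped Kronecker ComplexOrder

namespace ConvexSplit

/-! ### Scalar inequalities -/

/-- Jensen's inequality for the logarithm, where the points only have to be positive on the support
of the weights. -/
theorem sum_mul_log_le_log_sum {ι : Type*} [Fintype ι] (P z : ι → ℝ) (hP : ∀ i, 0 ≤ P i)
    (hsum : ∑ i, P i = 1) (hz : ∀ i, P i ≠ 0 → 0 < z i) :
    0 < ∑ i, P i * z i ∧ ∑ i, P i * Real.log (z i) ≤ Real.log (∑ i, P i * z i) := by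
  have hterm : ∀ i, 0 ≤ P i * z i := fun i => by
    rcases eq_or_ne (P i) 0 with h | h
    · simp [h]
    · exact mul_nonneg (hP i) (hz i h).le
  have hpos : 0 < ∑ i, P i * z i := by
    obtain ⟨i, -, hi⟩ := Finset.exists_ne_zero_of_sum_ne_zero (hsum.trans_ne one_ne_zero)
    exact Finset.sum_pos' (fun i _ => hterm i) ⟨i, Finset.mem_univ _,
      mul_pos ((hP i).lt_of_ne' hi) (hz i hi)⟩
  refine ⟨hpos, ?_⟩
  set Q := ∑ i, P i * z i with hQ
  have key : ∀ i, P i * Real.log (z i) ≤ P i * Real.log Q + (P i * z i / Q - P i) := fun i => by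
    rcases eq_or_ne (P i) 0 with h | h
    · simp [h]
    · have h1 := Real.log_le_sub_one_of_pos (div_pos (hz i h) hpos)
      rw [Real.log_div (hz i h).ne' hpos.ne'] at h1
      have h2 := mul_le_mul_of_nonneg_left h1 (hP i)
      rw [mul_div_assoc]
      linarith
  refine (Finset.sum_le_sum fun i _ => key i).trans_eq ?_
  rw [Finset.sum_add_distrib, Finset.sum_sub_distrib, ← Finset.sum_mul, ← Finset.sum_div, hsum,
    ← hQ, div_self hpos.ne']
  ring

/-- The classical comparison of Rényi divergences of orders `1 / 2`, `1` and `2`, for the joint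
weights `p i * w i` and the likelihood ratio `p i / q i`. -/
theorem classical_renyi_bounds {ι : Type*} [Fintype ι] (p q w : ι → ℝ) (hp : ∀ i, 0 ≤ p i)
    (hq : ∀ i, 0 ≤ q i) (hw : ∀ i, 0 ≤ w i) (hsum : ∑ i, p i * w i = 1)
    (hsupp : ∀ i, q i = 0 → p i * w i = 0) :
    0 < ∑ i, p i ^ 2 * (q i)⁻¹ * w i ∧
    ∑ i, p i * w i * (Real.logb 2 (p i) - Real.logb 2 (q i)) ≤
      Real.logb 2 (∑ i, p i ^ 2 * (q i)⁻¹ * w i) ∧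
    1 / (∑ i, p i ^ 2 * (q i)⁻¹ * w i) ≤ (∑ i, √(p i) * √(q i) * w i) ^ 2 := by
  have hP : ∀ i, 0 ≤ p i * w i := fun i => mul_nonneg (hp i) (hw i)
  have hpp : ∀ i, p i * w i ≠ 0 → 0 < p i := fun i h =>
    (hp i).lt_of_ne' (left_ne_zero_of_mul h)
  have hqp : ∀ i, p i * w i ≠ 0 → 0 < q i := fun i h =>
    (hq i).lt_of_ne' fun h0 => h (hsupp i h0)
  obtain ⟨hQ, hD⟩ := sum_mul_log_le_log_sum (fun i => p i * w i) (fun i => p i / q i) hP hsum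
    fun i h => div_pos (hpp i h) (hqp i h)
  obtain ⟨hF, hE⟩ := sum_mul_log_le_log_sum (fun i => p i * w i) (fun i => √(q i) / √(p i)) hP hsum
    fun i h => div_pos (Real.sqrt_pos.2 (hqp i h)) (Real.sqrt_pos.2 (hpp i h))
  have eQ : ∑ i, p i * w i * (p i / q i) = ∑ i, p i ^ 2 * (q i)⁻¹ * w i :=
    Finset.sum_congr rfl fun i _ => by rw [div_eq_mul_inv]; ring
  have eF : ∑ i, p i * w i * (√(q i) / √(p i)) = ∑ i, √(p i) * √(q i) * w i :=
    Finset.sum_congr rfl fun i _ => by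
      rcases (hp i).eq_or_lt with h | h
      · simp [← h]
      · have h2 := Real.sqrt_pos.2 h
        nth_rw 1 [← Real.mul_self_sqrt h.le]
        field_simp
  have eE : ∑ i, p i * w i * Real.log (√(q i) / √(p i)) =
      -(1 / 2) * ∑ i, p i * w i * Real.log (p i / q i) := by
    rw [Finset.mul_sum]
    refine Finset.sum_congr rfl fun i _ => ?_
    rcases eq_or_ne (p i * w i) 0 with h | h
    · simp [h]
    · rw [Real.log_div (Real.sqrt_pos.2 (hqp i h)).ne' (Real.sqrt_pos.2 (hpp i h)).ne',
        Real.log_div (hpp i h).ne' (hqp i h).ne', Real.log_sqrt (hq i), Real.log_sqrt (hp i)]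
      ring
  rw [eQ] at hQ hD
  rw [eF] at hF hE
  rw [eE] at hE
  refine ⟨hQ, ?_, ?_⟩
  · have : ∑ i, p i * w i * (Real.logb 2 (p i) - Real.logb 2 (q i)) =
        (∑ i, p i * w i * Real.log (p i / q i)) / Real.log 2 := by
      rw [Finset.sum_div]
      refine Finset.sum_congr rfl fun i _ => ?_
      rcases eq_or_ne (p i * w i) 0 with h | h
      · simp [h]
      · rw [Real.log_div (hpp i h).ne' (hqp i h).ne', Real.logb, Real.logb]
        ring
    rw [this, Real.logb]
    exact div_le_div_of_nonneg_right hD (Real.log_pos one_lt_two).le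
  · rw [← Real.log_le_log_iff (by positivity) (by positivity), Real.log_pow, one_div, Real.log_inv]
    push_cast
    linarith

/-! ### Functional calculus of a pair of Hermitian matrices -/

section
variable {n : Type*} [Fintype n] [DecidableEq n]

/-- The squared overlaps `|⟨a|b⟩|²` of the vectors of eigenbases of two Hermitian matrices. -/
noncomputable def overlap {A B : Matrix n n ℂ} (hA : A.IsHermitian) (hB : B.IsHermitian)
    (x : n × n) : ℝ :=
  Complex.normSq ((star (hA.eigenvectorUnitary : Matrix n n ℂ) *
    (hB.eigenvectorUnitary : Matrix n n ℂ)) x.1 x.2)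

theorem trace_cfc_mul_cfc {A B : Matrix n n ℂ} (hA : A.IsHermitian) (hB : B.IsHermitian)
    (f g : ℝ → ℝ) :
    (cfc f A * cfc g B).trace.re =
      ∑ x : n × n, f (hA.eigenvalues x.1) * g (hB.eigenvalues x.2) * overlap hA hB x := by
  rw [hA.cfc_eq, hB.cfc_eq, Matrix.IsHermitian.cfc, Matrix.IsHermitian.cfc,
    Unitary.conjStarAlgAut_apply, Unitary.conjStarAlgAut_apply]
  set V : Matrix n n ℂ := hA.eigenvectorUnitary.1 with hV
  set W : Matrix n n ℂ := hB.eigenvectorUnitary.1 with hW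
  have h1 : ∀ D E : Matrix n n ℂ, (V * D * star V * (W * E * star W)).trace =
      (D * (star V * W) * (E * star (star V * W))).trace := fun D E => by
    rw [star_mul, star_star]
    rw [show V * D * star V * (W * E * star W) = V * (D * star V * (W * E * star W)) by
      simp only [mul_assoc], Matrix.trace_mul_comm]
    simp only [mul_assoc]
  rw [h1, Matrix.trace, Complex.re_sum, Fintype.sum_prod_type]
  refine Finset.sum_congr rfl fun a _ => ?_
  rw [Matrix.diag_apply, Matrix.mul_apply, Complex.re_sum]
  refine Finset.sum_congr rfl fun b _ => ?_
  rw [Matrix.diagonal_mul, Matrix.diagonal_mul, Matrix.star_apply, overlap]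
  set z := (star V * W) a b
  have : (((Complex.ofReal ∘ f ∘ hA.eigenvalues) a * z) *
      ((Complex.ofReal ∘ g ∘ hB.eigenvalues) b * star z)) =
      ((f (hA.eigenvalues a) * g (hB.eigenvalues b) * Complex.normSq z : ℝ) : ℂ) := by
    push_cast
    rw [Complex.normSq_eq_conj_mul_self]
    simp only [Function.comp, starRingEnd_apply]
    ring
  exact congrArg Complex.re this

/-- The trace is dominated by the trace norm: `Tr X = ∑ ⟨v, X v⟩ ≤ ∑ ‖X v‖`, over the vectors of an
eigenbasis of `X† X`. -/
theorem re_trace_le_traceNorm (X : Matrix n n ℂ) : X.trace.re ≤ traceNorm X := by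
  have hH : (X.conjTranspose * X).IsHermitian := Matrix.isHermitian_conjTranspose_mul_self X
  set V : Matrix n n ℂ := hH.eigenvectorUnitary.1 with hV
  have hVV : V * star V = 1 := Unitary.coe_mul_star_self _
  have hVV' : star V * V = 1 := Unitary.coe_star_mul_self _
  have hr : traceNorm X = ∑ i, √(hH.eigenvalues i) := by
    rw [traceNorm, hH.cfc_eq, Matrix.IsHermitian.cfc, Unitary.conjStarAlgAut_apply,
      Matrix.trace_mul_cycle, Unitary.coe_star_mul_self, one_mul, Matrix.trace_diagonal,
      Complex.re_sum]
    rfl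
  have hl : X.trace = ∑ i, (star V * X * V) i i := by
    change _ = (star V * X * V).trace
    rw [Matrix.trace_mul_cycle, hVV, one_mul]
  rw [hr, hl, Complex.re_sum]
  refine Finset.sum_le_sum fun i _ => ?_
  refine (Complex.re_le_norm _).trans (Real.le_sqrt_of_sq_le ?_)
  have hd : (star (star V * X * V) * (star V * X * V)) i i = (hH.eigenvalues i : ℂ) := by
    have h2 : star (star V * X * V) * (star V * X * V) =
        star V * (X.conjTranspose * X) * V := by
      rw [star_mul, star_mul, star_star, Matrix.star_eq_conjTranspose X]
      calc _ = star V * (X.conjTranspose * (V * star V) * X) * V := by simp only [mul_assoc]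
        _ = _ := by rw [hVV, mul_one]
    rw [h2]
    have h3 := hH.spectral_theorem
    rw [Unitary.conjStarAlgAut_apply] at h3
    have h4 : ∀ D : Matrix n n ℂ, star V * (V * D * star V) * V = D := fun D => by
      calc _ = (star V * V) * D * (star V * V) := by simp only [mul_assoc]
        _ = D := by rw [hVV', one_mul, mul_one]
    have h5 := (congrArg (fun M => star V * M * V) h3).trans (h4 _)
    exact (congrFun (congrFun h5 i) i).trans (Matrix.diagonal_apply_eq _ _)
  have hd' := congrArg Complex.re hd
  rw [Matrix.mul_apply, Complex.re_sum, Complex.ofReal_re] at hd'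
  rw [← hd']
  have h5 : ∀ j, (star (star V * X * V) i j * (star V * X * V) j i).re =
      ‖(star V * X * V) j i‖ ^ 2 := fun j => by
    rw [Matrix.star_apply, ← Complex.normSq_eq_norm_sq, ← Complex.ofReal_re (Complex.normSq _),
      Complex.normSq_eq_conj_mul_self]
    rfl
  simp only [h5]
  exact Finset.single_le_sum (f := fun j => ‖(star V * X * V) j i‖ ^ 2)
    (fun j _ => by positivity) (Finset.mem_univ i)

theorem continuousOn_spectrum (A : Matrix n n ℂ) (f : ℝ → ℝ) : ContinuousOn f (spectrum ℝ A) :=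
  A.finite_real_spectrum.continuousOn f

/-- If `ρ = σ X`, then `Re Tr(ρ X)` is `2` to the power of the Petz–Rényi divergence of order `2`
of `ρ` relative to `σ`. It bounds the relative entropy and the fidelity. -/
theorem relEntropy_le_and_le_fidelity {ρ σ X : Matrix n n ℂ} (hρ : IsState ρ) (hσ : σ.PosSemidef)
    (hX : σ * X = ρ) :
    0 < (ρ * X).trace.re ∧
    relEntropy ρ σ ≤ ((Real.logb 2 (ρ * X).trace.re : ℝ) : EReal) ∧
    1 / (ρ * X).trace.re ≤ fidelity ρ σ ^ 2 := by
  have hA : ρ.IsHermitian := hρ.1.1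
  have hB : σ.IsHermitian := hσ.1
  have sA : IsSelfAdjoint ρ := hA
  have sB : IsSelfAdjoint σ := hB
  have cA := continuousOn_spectrum ρ
  have cB := continuousOn_spectrum σ
  have hXt : X.conjTranspose * σ = ρ := by
    rw [← hB.eq, ← Matrix.conjTranspose_mul, hX, hA.eq]
  have hker : ∀ v : n → ℂ, σ.mulVec v = 0 → ρ.mulVec v = 0 := fun v hv => by
    rw [← hXt, ← Matrix.mulVec_mulVec, hv, Matrix.mulVec_zero]
  set p : n × n → ℝ := fun x => hA.eigenvalues x.1
  set q : n × n → ℝ := fun x => hB.eigenvalues x.2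
  set w := overlap hA hB
  have hw : ∀ x, 0 ≤ w x := fun x => Complex.normSq_nonneg _
  have hp : ∀ x, 0 ≤ p x := fun x => hρ.1.eigenvalues_nonneg _
  have hq : ∀ x, 0 ≤ q x := fun x => hσ.eigenvalues_nonneg _
  have hsum : ∑ x, p x * w x = 1 := by
    have h := trace_cfc_mul_cfc hA hB (fun x => x) (fun _ => 1)
    rw [cfc_id' ℝ ρ, cfc_const_one ℝ σ, mul_one, hρ.2] at h
    simpa [p, w] using h.symm
  have hsupp : ∀ x, q x = 0 → p x * w x = 0 := by
    have h := trace_cfc_mul_cfc hA hB (fun x => x) (fun x => if x = 0 then 1 else 0)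
    have h0 : σ * cfc (fun x : ℝ => if x = 0 then (1 : ℝ) else 0) σ = 0 := by
      nth_rw 1 [← cfc_id' ℝ σ]
      rw [← cfc_mul _ _ σ (cB _) (cB _), ← cfc_const_zero ℝ σ]
      exact cfc_congr fun x _ => by simp
    have h' : ρ * cfc (fun x : ℝ => if x = 0 then (1 : ℝ) else 0) σ = 0 := by
      nth_rw 1 [← hXt]
      rw [mul_assoc, h0, mul_zero]
    rw [cfc_id' ℝ ρ, h', Matrix.trace_zero, Complex.zero_re] at h
    have h1 := (Finset.sum_eq_zero_iff_of_nonneg (fun x _ =>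
      mul_nonneg (mul_nonneg (hp x) (by split_ifs <;> norm_num)) (hw x))).1 h.symm
    intro x hx
    have := h1 x (Finset.mem_univ _)
    rwa [if_pos hx, mul_one] at this
  have hQ : (ρ * X).trace.re = ∑ x, p x ^ 2 * (q x)⁻¹ * w x := by
    rw [← trace_cfc_mul_cfc hA hB (fun x => x ^ 2) (fun x => x⁻¹)]
    have h0 : σ * cfc (fun x : ℝ => x⁻¹) σ * σ = σ := by
      have h1 : cfc (fun x : ℝ => x) σ * cfc (fun x : ℝ => x⁻¹) σ * cfc (fun x : ℝ => x) σ =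
          cfc (fun x : ℝ => x) σ := by
        rw [← cfc_mul _ _ σ (cB _) (cB _), ← cfc_mul _ _ σ (cB _) (cB _)]
        exact cfc_congr fun x _ => mul_inv_mul_cancel x
      rwa [cfc_id' ℝ σ] at h1
    have h1 : cfc (fun x : ℝ => x ^ 2) ρ = ρ * ρ := by
      rw [cfc_pow_id ρ 2, sq]
    rw [h1, mul_assoc, Matrix.trace_mul_comm ρ (ρ * _)]
    congr 2
    conv_rhs =>
      enter [1, 1]
      rw [← hXt]
    conv_rhs =>
      enter [2]
      rw [← hX]
    rw [← hXt]
    nth_rw 1 [← h0]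
    simp only [mul_assoc]
  obtain ⟨h1, h2, h3⟩ := classical_renyi_bounds p q w hp hq hw hsum hsupp
  rw [← hQ] at h1 h2 h3
  refine ⟨h1, ?_, ?_⟩
  · rw [relEntropy, if_pos hker, EReal.coe_le_coe_iff]
    refine le_of_eq_of_le ?_ h2
    have e1 : ρ * cfc (Real.logb 2) ρ =
        cfc (fun x => x * Real.logb 2 x) ρ * cfc (fun _ => (1 : ℝ)) σ := by
      rw [cfc_const_one ℝ σ, mul_one, cfc_mul _ _ ρ (cA _) (cA _), cfc_id' ℝ ρ]
    have e2 : ρ * cfc (Real.logb 2) σ = cfc (fun x : ℝ => x) ρ * cfc (Real.logb 2) σ := by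
      rw [cfc_id' ℝ ρ]
    rw [mul_sub, Matrix.trace_sub, Complex.sub_re, e1, e2, trace_cfc_mul_cfc hA hB,
      trace_cfc_mul_cfc hA hB, ← Finset.sum_sub_distrib]
    exact Finset.sum_congr rfl fun x _ => by simp only [p, q, w]; ring
  · have h4 := re_trace_le_traceNorm (cfc Real.sqrt ρ * cfc Real.sqrt σ)
    rw [trace_cfc_mul_cfc hA hB] at h4
    refine h3.trans (pow_le_pow_left₀ (Finset.sum_nonneg fun x _ => ?_) h4 2)
    exact mul_nonneg (mul_nonneg (Real.sqrt_nonneg _) (Real.sqrt_nonneg _)) (hw x)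

open scoped MatrixOrder in
/-- Douglas factorization of `A` through a positive semidefinite `B` that dominates it, with control
of the factor. -/
theorem exists_factor_of_le {A B : Matrix n n ℂ} (hA : A.PosSemidef) (hB : B.PosSemidef) {c : ℝ}
    (hc : 0 < c) (h : (c • B - A).PosSemidef) :
    ∃ Y, B * Y = A ∧ (A * Y).trace.re ≤ c * A.trace.re := by
  have sB : IsSelfAdjoint B := hB.1
  have cB := continuousOn_spectrum B
  obtain ⟨Y, hY⟩ : ∃ Y, B * Y = A := by
    set P := cfc (fun x : ℝ => if x = 0 then (1 : ℝ) else 0) B with hPdef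
    have hP : P.conjTranspose = P := (cfc_predicate (R := ℝ) _ B : IsSelfAdjoint _)
    have hBP : B * P = 0 := by
      nth_rw 1 [← cfc_id' ℝ B]
      rw [hPdef, ← cfc_mul _ _ B (cB _) (cB _), ← cfc_const_zero ℝ B]
      exact cfc_congr fun x _ => by simp
    have hsplit : B * cfc (fun x : ℝ => x⁻¹) B + P = 1 := by
      nth_rw 1 [← cfc_id' ℝ B]
      rw [hPdef, ← cfc_mul _ _ B (cB _) (cB _), ← cfc_add _ _ _ (cB _) (cB _),
        ← cfc_const_one ℝ B]
      exact cfc_congr fun x _ => by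
        rcases eq_or_ne x 0 with h | h
        · simp [h]
        · simp [h]
    have h1 := hA.conjTranspose_mul_mul_same P
    have h2 := h.conjTranspose_mul_mul_same P
    have h3 : P.conjTranspose * A * P = 0 := by
      rw [← h1.trace_eq_zero_iff]
      refine le_antisymm ?_ h1.trace_nonneg
      have := h2.trace_nonneg
      rwa [mul_assoc, sub_mul, smul_mul_assoc, hBP, smul_zero, zero_sub, mul_neg, ← mul_assoc,
        Matrix.trace_neg, neg_nonneg] at this
    obtain ⟨C, rfl⟩ := CStarAlgebra.nonneg_iff_eq_star_mul_self.1 hA.nonneg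
    rw [Matrix.star_eq_conjTranspose] at *
    have h4 : C * P = 0 := by
      rw [← Matrix.conjTranspose_mul_self_eq_zero, Matrix.conjTranspose_mul, ← h3]
      simp only [mul_assoc]
    have h5 : P * C.conjTranspose = 0 := by
      rw [← hP, ← Matrix.conjTranspose_mul, h4, Matrix.conjTranspose_zero]
    refine ⟨cfc (fun x : ℝ => x⁻¹) B * (C.conjTranspose * C), ?_⟩
    calc _ = (B * cfc (fun x : ℝ => x⁻¹) B + P) * (C.conjTranspose * C) - P * C.conjTranspose * C
          := by simp only [mul_assoc, add_mul]; abel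
      _ = _ := by rw [hsplit, h5, zero_mul, sub_zero, one_mul]
  refine ⟨Y, hY, ?_⟩
  -- `(c - Y)† A (c - Y) + Y† (c B - A) Y = c (c A - A Y)` because `Y† A = Y† B Y = A Y`.
  have hYA : Y.conjTranspose * B = A := by
    rw [← hB.1.eq, ← Matrix.conjTranspose_mul, hY, hA.1.eq]
  have hYA' : Y.conjTranspose * A = A * Y := by
    rw [← hY, ← mul_assoc, hYA, hY]
  have h1 := (hA.conjTranspose_mul_mul_same (c • 1 - Y)).trace_nonneg
  have h2 := (h.conjTranspose_mul_mul_same Y).trace_nonneg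
  have e : (c • 1 - Y).conjTranspose * A * (c • 1 - Y) +
      Y.conjTranspose * (c • B - A) * Y = c • (c • A - A * Y) := by
    rw [Matrix.conjTranspose_sub, Matrix.conjTranspose_smul, Matrix.conjTranspose_one]
    simp only [sub_mul, mul_sub, smul_mul_assoc, mul_smul_comm, one_mul, mul_one, hYA, hYA',
      star_trivial, smul_sub]
    abel
  have h3 := add_nonneg h1 h2
  rw [← Matrix.trace_add, e, Matrix.trace_smul, Matrix.trace_sub, Matrix.trace_smul] at h3
  have h4 := (Complex.le_def.1 h3).1
  simp only [Complex.zero_re, Complex.smul_re, Complex.sub_re, smul_eq_mul] at h4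
  have := nonneg_of_mul_nonneg_right h4 hc
  linarith

end

/-! ### The max-relative entropy -/

section
variable {n : Type*} [Fintype n]

/-- The infimum defining the max-relative entropy is attained, since the cone of positive
semidefinite matrices is closed. It is bounded below by `0` by comparison of traces. -/
theorem exists_dMax_eq {ρ σ : Matrix n n ℂ} (hρ : IsState ρ) (hσ : IsState σ)
    (h : ∃ l : ℝ, (((2 : ℝ) ^ l) • σ - ρ).PosSemidef) :
    ∃ k : ℝ, dMax ρ σ = (k : EReal) ∧ (((2 : ℝ) ^ k) • σ - ρ).PosSemidef := by
  set L : Set ℝ := {l : ℝ | (((2 : ℝ) ^ l) • σ - ρ).PosSemidef} with hL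
  have hbdd : ∀ l ∈ L, 0 ≤ l := fun l hl => by
    have h1 := (Complex.le_def.1 (Matrix.PosSemidef.trace_nonneg hl)).1
    rw [Matrix.trace_sub, Matrix.trace_smul, hρ.2, hσ.2] at h1
    simp only [Complex.zero_re, Complex.sub_re, Complex.smul_re, Complex.one_re, smul_eq_mul,
      mul_one, sub_nonneg] at h1
    by_contra! h2
    exact absurd h1 (not_le.2 (Real.rpow_lt_one_of_one_lt_of_neg one_lt_two h2))
  have hBdd : BddBelow L := ⟨0, hbdd⟩
  have hmem : sInf L ∈ L := by
    refine Matrix.PosSemidef.of_dotProduct_mulVec_nonneg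
      ((hσ.1.1.smul (IsSelfAdjoint.all _)).sub hρ.1.1) fun x => ?_
    have hcl : IsClosed {l : ℝ | 0 ≤ star x ⬝ᵥ ((((2 : ℝ) ^ l) • σ - ρ).mulVec x)} := by
      refine isClosed_le continuous_const ?_
      simp only [Matrix.sub_mulVec, Matrix.smul_mulVec, dotProduct_sub, dotProduct_smul]
      have : Continuous fun l : ℝ => (2 : ℝ) ^ l :=
        Real.continuous_const_rpow two_ne_zero
      fun_prop
    exact hcl.closure_subset_iff.2 (fun l hl => Matrix.PosSemidef.dotProduct_mulVec_nonneg hl x)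
      (csInf_mem_closure h hBdd)
  refine ⟨sInf L, le_antisymm (iInf₂_le _ hmem) (le_iInf₂ fun l hl => ?_), hmem⟩
  exact EReal.coe_le_coe_iff.2 (csInf_le hBdd hl)

theorem isState_maxMixed [DecidableEq n] [Nonempty n] : IsState (maxMixed n) := by
  refine ⟨Matrix.PosSemidef.one.smul ?_, ?_⟩
  · positivity
  · rw [maxMixed, Matrix.trace_smul, Matrix.trace_one, smul_eq_mul,
      inv_mul_cancel₀ (Nat.cast_ne_zero.2 Fintype.card_ne_zero)]

variable {m : Type*}

theorem IsState.kronecker [Fintype m] {ρ : Matrix m m ℂ} {σ : Matrix n n ℂ} (hρ : IsState ρ)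
    (hσ : IsState σ) : IsState (ρ ⊗ₖ σ) :=
  ⟨hρ.1.kronecker hσ.1, by rw [Matrix.trace_kronecker, hρ.2, hσ.2, one_mul]⟩

theorem marginalLeft_eq_sum (ρ : Matrix (m × n) (m × n) ℂ) :
    marginalLeft ρ = ∑ c, ρ.submatrix (fun r => (r, c)) (fun r => (r, c)) := by
  ext a b
  simp [marginalLeft, Matrix.sum_apply]

theorem IsState.marginalLeft [Fintype m] {ρ : Matrix (m × n) (m × n) ℂ} (hρ : IsState ρ) :
    IsState (marginalLeft ρ) := by
  refine ⟨?_, ?_⟩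
  · rw [marginalLeft_eq_sum]
    exact Matrix.posSemidef_sum _ fun c _ => hρ.1.submatrix _
  · rw [← hρ.2, Matrix.trace, Matrix.trace, Fintype.sum_prod_type]
    rfl

/-- The matrix `d 1 - J`, with `J` the all-ones matrix, is positive semidefinite: it is `d` times
a projection. -/
theorem posSemidef_card_sub_ones [DecidableEq n] :
    (Matrix.of fun c c' : n => (if c = c' then (Fintype.card n : ℂ) else 0) - 1).PosSemidef := by
  set H := Matrix.of fun c c' : n => (if c = c' then (Fintype.card n : ℂ) else 0) - 1 with hH
  have h1 : H.conjTranspose * H = (Fintype.card n : ℂ) • H := by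
    ext a b
    simp only [hH, Matrix.mul_apply, Matrix.conjTranspose_apply, Matrix.of_apply,
      Matrix.smul_apply, smul_eq_mul, star_sub, star_one, apply_ite star, star_natCast, star_zero,
      sub_mul, mul_sub, Finset.sum_sub_distrib, ite_mul, zero_mul, mul_one, one_mul,
      Finset.sum_ite_eq', Finset.mem_univ, if_true, Finset.sum_const,
      Finset.card_univ, nsmul_eq_mul]
    ring
  rcases isEmpty_or_nonempty n with hn | hn
  · rw [Subsingleton.elim H 0]
    exact Matrix.PosSemidef.zero
  · have h2 : H = ((Fintype.card n : ℂ)⁻¹) • (H.conjTranspose * H) := by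
      rw [h1, smul_smul, inv_mul_cancel₀ (Nat.cast_ne_zero.2 Fintype.card_ne_zero), one_smul]
    rw [h2]
    exact (Matrix.posSemidef_conjTranspose_mul_self H).smul (by positivity)

/-- A positive semidefinite `ρ` on `m × n` is at most `dim n • (ρ_m ⊗ 1)`. The pinched matrix
`∑ c, |c⟩⟨c| ρ |c⟩⟨c|` interpolates between the two sides. -/
theorem posSemidef_card_smul_marginalLeft_sub [Fintype m] [DecidableEq n]
    {ρ : Matrix (m × n) (m × n) ℂ} (hρ : ρ.PosSemidef) :
    ((Fintype.card n : ℝ) • (marginalLeft ρ ⊗ₖ (1 : Matrix n n ℂ)) - ρ).PosSemidef := by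
  have h1 : (Matrix.hadamard ρ ((Matrix.of fun c c' : n =>
      (if c = c' then (Fintype.card n : ℂ) else 0) - 1).submatrix
        (Prod.snd : m × n → n) Prod.snd)).PosSemidef :=
    hρ.hadamard (posSemidef_card_sub_ones.submatrix _)
  have h2 : (∑ e, ρ.submatrix (fun r => (r, e)) (fun r => (r, e)) ⊗ₖ
      Matrix.diagonal fun c : n => if c = e then (0 : ℂ) else Fintype.card n).PosSemidef := by
    refine Matrix.posSemidef_sum _ fun e _ => (hρ.submatrix _).kronecker
      (Matrix.PosSemidef.diagonal fun c => ?_)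
    dsimp only [Pi.zero_apply]
    split_ifs
    · exact le_rfl
    · positivity
  convert h1.add h2 using 1
  ext ⟨r, c⟩ ⟨r', c'⟩
  simp only [Matrix.sub_apply, Matrix.smul_apply, Matrix.kroneckerMap_apply, Matrix.add_apply,
    Matrix.hadamard_apply, Matrix.submatrix_apply, Matrix.of_apply, Matrix.sum_apply, marginalLeft,
    Complex.real_smul, Complex.ofReal_natCast]
  rcases eq_or_ne c c' with rfl | hc
  · have h3 : ∀ e : n, ρ (r, e) (r', e) * (if c = e then (0 : ℂ) else Fintype.card n) =
        ρ (r, e) (r', e) * Fintype.card n -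
          if c = e then ρ (r, e) (r', e) * Fintype.card n else 0 := fun e => by
      split_ifs <;> simp
    simp only [Matrix.one_apply_eq, Matrix.diagonal_apply_eq, if_true, h3, Finset.sum_sub_distrib,
      Finset.sum_ite_eq, Finset.mem_univ, ← Finset.sum_mul]
    ring
  · simp [hc]

theorem exists_posSemidef_rpow_smul_sub [Fintype m] [DecidableEq n] [Nonempty n]
    {ρ : Matrix (m × n) (m × n) ℂ}
    (hρ : ρ.PosSemidef) :
    ∃ l : ℝ, (((2 : ℝ) ^ l) • (marginalLeft ρ ⊗ₖ maxMixed n) - ρ).PosSemidef := by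
  have hc : (0 : ℝ) < Fintype.card n := Nat.cast_pos.2 Fintype.card_pos
  refine ⟨Real.logb 2 (Fintype.card n * Fintype.card n), ?_⟩
  rw [Real.rpow_logb two_pos (by norm_num) (by positivity)]
  convert posSemidef_card_smul_marginalLeft_sub hρ using 2
  rw [maxMixed, Matrix.kronecker_smul]
  ext a b
  simp only [Matrix.smul_apply, Complex.real_smul, smul_eq_mul]
  have : (Fintype.card n : ℂ) ≠ 0 := Nat.cast_ne_zero.2 Fintype.card_ne_zero
  push_cast
  field_simp

end

/-! ### The embedding of the register `G` -/

section
variable {d g : ℕ} [NeZero g]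

theorem basisG_injective (h : g ≤ 2 * (d * d)) : Function.Injective (basisG h) := fun i j hij => by
  apply ZMod.val_injective g
  rw [← basisG_label h i, ← basisG_label h j, hij]

theorem exists_basisG_eq (hlow : d * d ≤ g) (h : g ≤ 2 * (d * d)) (c c' : Fin d) :
    ∃ i, basisG h i = (0, c, c') := by
  have hlt : (finProdFinEquiv (c, c') : Fin (d * d)).val < g := (Fin.is_lt _).trans_le hlow
  refine ⟨((finProdFinEquiv (c, c') : Fin (d * d)).val : ZMod g), ?_⟩
  have h1 : finProdFinEquiv.symm (Fin.castLE h ⟨_, ZMod.val_lt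
      ((finProdFinEquiv (c, c') : Fin (d * d)).val : ZMod g)⟩) =
      ((0 : Fin 2), finProdFinEquiv (c, c')) := by
    rw [Equiv.symm_apply_eq]
    ext
    refine (ZMod.val_natCast_of_lt hlt).trans ?_
    simp only [finProdFinEquiv_apply_val, Fin.val_zero, mul_zero, add_zero]
  simp only [basisG, h1, Equiv.symm_apply_apply]

/-- As `d² ≤ g`, the register `G` contains the whole subspace `|0⟩ ⊗ C ⊗ C`. -/
theorem sum_basisG (hlow : d * d ≤ g) (h : g ≤ 2 * (d * d)) (F : Fin 2 × Fin d × Fin d → ℂ)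
    (hF : ∀ x, x.1 ≠ 0 → F x = 0) :
    ∑ i, F (basisG h i) = ∑ c, ∑ c', F (0, c, c') := by
  rw [← Finset.sum_image (f := F) (s := Finset.univ) fun i _ j _ hij => basisG_injective h hij,
    Finset.sum_subset (Finset.subset_univ _), Fintype.sum_prod_type, Fin.sum_univ_two,
    Fintype.sum_prod_type, add_eq_left]
  · exact Finset.sum_eq_zero fun x _ => hF _ (by simp)
  · rintro ⟨q, c, c'⟩ - hx
    refine hF _ fun hq => hx ?_
    obtain ⟨i, hi⟩ := exists_basisG_eq hlow h c c'
    exact Finset.mem_image.2 ⟨i, Finset.mem_univ _, by rw [hi, ← hq]⟩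

theorem nonempty_fin_of_le (h : g ≤ 2 * (d * d)) : Nonempty (Fin d) := by
  rcases Nat.eq_zero_or_pos d with rfl | hd
  · exact absurd (Nat.le_zero.1 h) (NeZero.ne g)
  · exact ⟨⟨0, hd⟩⟩

variable {R : Type*}

theorem posSemidef_stateRG [Finite R] (h : g ≤ 2 * (d * d)) {Ψ : Matrix (R × Fin d) (R × Fin d) ℂ}
    (hΨ : Ψ.PosSemidef) : (stateRG h Ψ).PosSemidef := by
  have := nonempty_fin_of_le h
  have h1 : ketbraZero.PosSemidef := by
    rw [ketbraZero, ← Matrix.diagonal_single]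
    exact Matrix.PosSemidef.diagonal (Pi.single_nonneg.2 zero_le_one)
  exact ((hΨ.kronecker h1).kronecker isState_maxMixed.1).submatrix _

theorem marginalLeft_stateRG (hlow : d * d ≤ g) (h : g ≤ 2 * (d * d))
    (Ψ : Matrix (R × Fin d) (R × Fin d) ℂ) :
    marginalLeft (stateRG h Ψ) = marginalLeft Ψ := by
  have := nonempty_fin_of_le h
  ext a b
  refine (sum_basisG hlow h (fun x => Ψ (a, x.2.1) (b, x.2.1) * ketbraZero x.1 x.1 *
    maxMixed (Fin d) x.2.2 x.2.2) fun x hx => ?_).trans ?_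
  · simp [ketbraZero, hx.symm]
  · refine Finset.sum_congr rfl fun c _ => ?_
    have h1 : ∑ c', maxMixed (Fin d) c' c' = 1 := (isState_maxMixed (n := Fin d)).2
    dsimp only
    rw [← Finset.mul_sum, h1]
    simp [ketbraZero]

/-- The inclusion of `G` in `Q ⊗ C ⊗ C` at most doubles the dimension, which costs a factor `2` in
the bound on `Ψ_{RC₀} ⊗ |0⟩⟨0| ⊗ μ_{C₁}`. -/
theorem posSemidef_smul_sub_stateRG [Fintype R] (h : g ≤ 2 * (d * d))
    {Ψ : Matrix (R × Fin d) (R × Fin d) ℂ} (hΨ : IsState Ψ) {t : ℝ} (ht : 0 ≤ t)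
    (hle : (t • (marginalLeft Ψ ⊗ₖ maxMixed (Fin d)) - Ψ).PosSemidef) :
    ((2 * t) • (marginalLeft Ψ ⊗ₖ maxMixed (ZMod g)) - stateRG h Ψ).PosSemidef := by
  have hne := nonempty_fin_of_le h
  have hd : (0 : ℝ) < d := by
    have : 0 < d := by simpa using Fin.pos_iff_nonempty.2 hne
    exact_mod_cast this
  have hg : (0 : ℝ) < g := Nat.cast_pos.2 (NeZero.pos g)
  have hgd : (g : ℝ) ≤ 2 * (d * d) := by exact_mod_cast h
  have h1 := posSemidef_stateRG h hle
  have h2 : (marginalLeft Ψ ⊗ₖ Matrix.diagonal fun i : ZMod g =>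
      ((2 * t / g - (if (basisG h i).1 = 0 then t / (d * d) else 0) : ℝ) : ℂ)).PosSemidef := by
    refine hΨ.marginalLeft.1.kronecker (Matrix.PosSemidef.diagonal fun i => ?_)
    refine Complex.zero_le_real.2 (sub_nonneg.2 ?_)
    split_ifs
    · rw [div_le_div_iff₀ (by positivity) hg]
      nlinarith
    · positivity
  convert h1.add h2 using 1
  ext ⟨r, i⟩ ⟨r', i'⟩
  simp only [stateRG, Matrix.sub_apply, Matrix.smul_apply, Matrix.kroneckerMap_apply,
    Matrix.add_apply, Matrix.submatrix_apply, Complex.real_smul, maxMixed, smul_eq_mul,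
    Fintype.card_fin, ZMod.card]
  rcases eq_or_ne i i' with rfl | hi
  · rw [Matrix.diagonal_apply_eq, Matrix.one_apply_eq, Matrix.one_apply_eq, Matrix.one_apply_eq]
    have hd' : (d : ℂ) ≠ 0 := by exact_mod_cast hd.ne'
    have hg' : (g : ℂ) ≠ 0 := by exact_mod_cast hg.ne'
    by_cases hq : (basisG h i).1 = 0
    · simp only [hq, ketbraZero, Matrix.single_apply_same, if_true]
      push_cast
      field_simp
      ring
    · simp only [ketbraZero, Matrix.single_apply, hq, Ne.symm hq, if_false, false_and]
      push_cast
      field_simp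
      ring
  · rw [Matrix.diagonal_apply_ne _ hi, Matrix.one_apply_ne hi]
    -- Off the diagonal of `G`, the operator `1_C ⊗ |0⟩⟨0| ⊗ 1_C` vanishes as `basisG` is injective.
    have h3 : (1 : Matrix (Fin d) (Fin d) ℂ) (basisG h i).2.1 (basisG h i').2.1 *
        ketbraZero (basisG h i).1 (basisG h i').1 *
        (1 : Matrix (Fin d) (Fin d) ℂ) (basisG h i).2.2 (basisG h i').2.2 = 0 := by
      by_contra hne
      apply hi
      apply basisG_injective h
      have e1 := right_ne_zero_of_mul hne
      have e2 := right_ne_zero_of_mul (left_ne_zero_of_mul hne)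
      have e3 := left_ne_zero_of_mul (left_ne_zero_of_mul hne)
      simp only [Matrix.one_apply, ketbraZero, Matrix.single_apply, ne_eq, ite_eq_right_iff,
        one_ne_zero, imp_false, not_not] at e1 e2 e3
      exact Prod.ext (e2.1.symm.trans e2.2) (Prod.ext e3 e1)
    linear_combination (-(t : ℂ) * marginalLeft Ψ r r' * (d : ℂ)⁻¹ * (d : ℂ)⁻¹) * h3

end

/-! ### The shears `U_ℓ` -/

theorem trace_submatrix_perm {n : Type*} [Fintype n] (M : Matrix n n ℂ) (e : Equiv.Perm n) :
    (M.submatrix e e).trace = M.trace :=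
  Equiv.sum_comp e fun i => M i i

section
variable {g : ℕ} {R : Type*}

/-- The permutation `(i, j) ↦ (i + (j - i) m, j + (j - i) m)` of the basis of `G₁ ⊗ G₂`, extended
by the identity on `R`. -/
def shear (R : Type*) (m : ZMod g) : Equiv.Perm (R × ZMod g × ZMod g) where
  toFun x := (x.1, x.2.1 + (x.2.2 - x.2.1) * m, x.2.2 + (x.2.2 - x.2.1) * m)
  invFun x := (x.1, x.2.1 - (x.2.2 - x.2.1) * m, x.2.2 - (x.2.2 - x.2.1) * m)
  left_inv x := by ext <;> dsimp only <;> ring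
  right_inv x := by ext <;> dsimp only <;> ring

theorem shear_apply (m : ZMod g) (r : R) (i j : ZMod g) :
    shear R m (r, i, j) = (r, i + (j - i) * m, j + (j - i) * m) := rfl

theorem shear_symm (m : ZMod g) : (shear R m).symm = shear R (-m) := by
  ext1 ⟨r, i, j⟩
  change (r, i - (j - i) * m, j - (j - i) * m) = _
  rw [shear_apply]
  congr 2 <;> ring

theorem shear_comp (l m : ZMod g) : shear R l ∘ shear R m = shear R (l + m) := by
  ext1 ⟨r, i, j⟩
  simp only [Function.comp, shear_apply]
  congr 2 <;> ring

theorem one_kronecker_U [NeZero g] [DecidableEq R] (l : ZMod g) :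
    (1 : Matrix R R ℂ) ⊗ₖ U l =
      (1 : Matrix (R × ZMod g × ZMod g) _ ℂ).submatrix (shear R l).symm (Equiv.refl _) := by
  have hU : ∀ a b : ZMod g × ZMod g, U l a b =
      if a = (b.1 + (b.2 - b.1) * l, b.2 + (b.2 - b.1) * l) then 1 else 0 := fun a b => by
    rw [U, Matrix.sum_apply]
    simp only [Matrix.sum_apply, Matrix.single_apply]
    rw [← Fintype.sum_prod_type']
    rw [Finset.sum_eq_single b]
    · simp [eq_comm]
    · rintro ⟨i, j⟩ - hb
      simp [hb]
    · simp
  ext ⟨r, a⟩ ⟨r', i, j⟩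
  simp only [Matrix.kroneckerMap_apply, hU, Matrix.submatrix_apply, Matrix.one_apply,
    Equiv.symm_apply_eq, Equiv.refl_apply, shear_apply, Prod.mk.injEq]
  by_cases h1 : r = r' <;> simp [h1]

theorem conj_one_kronecker_U [NeZero g] [Fintype R] [DecidableEq R] (l : ZMod g)
    (M : Matrix (R × ZMod g × ZMod g) (R × ZMod g × ZMod g) ℂ) :
    ((1 : Matrix R R ℂ) ⊗ₖ U l) * M * ((1 : Matrix R R ℂ) ⊗ₖ U l).conjTranspose =
      M.submatrix (shear R (-l)) (shear R (-l)) := by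
  rw [one_kronecker_U, Matrix.conjTranspose_submatrix, Matrix.conjTranspose_one,
    Matrix.one_submatrix_mul, Matrix.mul_submatrix_one, shear_symm]
  rfl

/-- The operator `M ⊗ N` on `R ⊗ (G₁ ⊗ G₂)`, for `M` on `R ⊗ G₁` and `N` on `G₂`. -/
def assocKron (M : Matrix (R × ZMod g) (R × ZMod g) ℂ) (N : Matrix (ZMod g) (ZMod g) ℂ) :
    Matrix (R × ZMod g × ZMod g) (R × ZMod g × ZMod g) ℂ :=
  Matrix.reindex (Equiv.prodAssoc R (ZMod g) (ZMod g)) (Equiv.prodAssoc R (ZMod g) (ZMod g))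
    (M ⊗ₖ N)

theorem assocKron_apply (M : Matrix (R × ZMod g) (R × ZMod g) ℂ)
    (N : Matrix (ZMod g) (ZMod g) ℂ) (r r' : R) (i i' j j' : ZMod g) :
    assocKron M N (r, i, j) (r', i', j') = M (r, i) (r', i') * N j j' := rfl

theorem assocKron_mul [NeZero g] [Fintype R] (M M' : Matrix (R × ZMod g) (R × ZMod g) ℂ)
    (N N' : Matrix (ZMod g) (ZMod g) ℂ) :
    assocKron M N * assocKron M' N' = assocKron (M * M') (N * N') := by
  rw [assocKron, assocKron, assocKron, Matrix.reindex_apply, Matrix.reindex_apply,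
    Matrix.reindex_apply, Matrix.submatrix_mul_equiv, Matrix.mul_kronecker_mul]

theorem trace_assocKron [NeZero g] [Fintype R] (M : Matrix (R × ZMod g) (R × ZMod g) ℂ)
    (N : Matrix (ZMod g) (ZMod g) ℂ) : (assocKron M N).trace = M.trace * N.trace := by
  rw [← Matrix.trace_kronecker]
  exact Equiv.sum_comp (Equiv.prodAssoc R (ZMod g) (ZMod g)).symm fun i => (M ⊗ₖ N) i i

theorem posSemidef_assocKron [NeZero g] [Finite R] {M : Matrix (R × ZMod g) (R × ZMod g) ℂ}
    {N : Matrix (ZMod g) (ZMod g) ℂ} (hM : M.PosSemidef) (hN : N.PosSemidef) :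
    (assocKron M N).PosSemidef :=
  (hM.kronecker hN).submatrix _

theorem assocKron_kronecker (ψ : Matrix R R ℂ) (M N : Matrix (ZMod g) (ZMod g) ℂ) :
    assocKron (ψ ⊗ₖ M) N = ψ ⊗ₖ (M ⊗ₖ N) :=
  Matrix.kronecker_assoc ψ M N

theorem shear_maxMixed [NeZero g] (ψ : Matrix R R ℂ) (m : ZMod g) :
    (ψ ⊗ₖ (maxMixed (ZMod g) ⊗ₖ maxMixed (ZMod g))).submatrix (shear R m) (shear R m) =
      ψ ⊗ₖ (maxMixed (ZMod g) ⊗ₖ maxMixed (ZMod g)) := by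
  have h1 : maxMixed (ZMod g) ⊗ₖ maxMixed (ZMod g) =
      (((g : ℂ)⁻¹) * ((g : ℂ)⁻¹)) • (1 : Matrix (ZMod g × ZMod g) (ZMod g × ZMod g) ℂ) := by
    rw [maxMixed, Matrix.smul_kronecker, Matrix.kronecker_smul, Matrix.one_kronecker_one,
      smul_smul, ZMod.card]
  rw [h1]
  ext ⟨r, i, j⟩ ⟨r', i', j'⟩
  have h2 : ((i + (j - i) * m, j + (j - i) * m) : ZMod g × ZMod g) =
      (i' + (j' - i') * m, j' + (j' - i') * m) ↔ (i, j) = (i', j') := by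
    have := (shear Unit m).injective.eq_iff (a := ((), i, j)) (b := ((), i', j'))
    simpa [shear_apply] using this
  simp only [Matrix.submatrix_apply, shear_apply, Matrix.kroneckerMap_apply, Matrix.smul_apply,
    Matrix.one_apply, h2]

end

/-- Pairwise independence: for `m ≠ 0`, the marginal on `R ⊗ G₁` of the image of `σ ⊗ μ` under a
shear is `σ_R ⊗ μ`. It is stated in the dual form, tested against an operator `Y` on `R ⊗ G₁`. -/
theorem trace_shear_mul {g : ℕ} [Fact g.Prime] {R : Type*} [Fintype R] [DecidableEq R]
    (σ Y : Matrix (R × ZMod g) (R × ZMod g) ℂ) {m : ZMod g} (hm : m ≠ 0) :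
    ((assocKron σ (maxMixed (ZMod g))).submatrix (shear R m) (shear R m) *
      assocKron Y 1).trace = ((marginalLeft σ ⊗ₖ maxMixed (ZMod g)) * Y).trace := by
  have key : ∀ (r r' : R) (i i' : ZMod g),
      ∑ j, σ (r, i + (j - i) * m) (r', i' + (j - i') * m) *
        maxMixed (ZMod g) (j + (j - i) * m) (j + (j - i') * m) =
      marginalLeft σ r r' * maxMixed (ZMod g) i i' := fun r r' i i' => by
    rcases eq_or_ne i i' with rfl | hi
    · have e : ∀ j : ZMod g, i + (j - i) * m = Equiv.addRight (i - i * m) (Equiv.mulRight₀ m hm j) :=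
        fun j => by
          change _ = j * m + (i - i * m)
          ring
      simp only [maxMixed, Matrix.smul_apply, Matrix.one_apply_eq, ← Finset.sum_mul]
      congr 1
      simp only [e]
      rw [Equiv.sum_comp (Equiv.mulRight₀ m hm)
        fun j => σ (r, Equiv.addRight (i - i * m) j) (r', Equiv.addRight (i - i * m) j),
        Equiv.sum_comp (Equiv.addRight (i - i * m)) fun j => σ (r, j) (r', j)]
      rfl
    · have e : ∀ j : ZMod g, j + (j - i) * m ≠ j + (j - i') * m := fun j h => by
        have := mul_right_cancel₀ hm (add_left_cancel h)
        exact hi (sub_right_injective this)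
      simp [maxMixed, Matrix.one_apply_ne hi, Matrix.one_apply_ne (e _)]
  simp only [Matrix.trace, Matrix.diag_apply, Matrix.mul_apply, Fintype.sum_prod_type,
    Matrix.submatrix_apply, shear_apply, assocKron_apply, Matrix.kroneckerMap_apply, ← key,
    Finset.sum_mul]
  refine Finset.sum_congr rfl fun r _ => Finset.sum_congr rfl fun i _ => ?_
  rw [Finset.sum_comm]
  refine Finset.sum_congr rfl fun r' _ => ?_
  rw [Finset.sum_comm]
  refine Finset.sum_congr rfl fun i' _ => Finset.sum_congr rfl fun j _ => ?_
  rw [Finset.sum_eq_single j]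
  · rw [Matrix.one_apply_eq, mul_one]
  · intro j' _ hj
    rw [Matrix.one_apply_ne hj, mul_zero, mul_zero]
  · simp

end ConvexSplit

open ConvexSplit in
theorem theorem2 {R : Type*} [Fintype R] [DecidableEq R] (d g : ℕ) [Fact g.Prime]
    (hlow : d * d ≤ g) (hup : g ≤ 2 * (d * d))
    (Ψ : Matrix (R × Fin d) (R × Fin d) ℂ) (hΨ : ConvexSplit.IsState Ψ)
    (S : Finset (ZMod g)) (hS : S.Nonempty) :
    ConvexSplit.IsState (ConvexSplit.tau hup Ψ S) ∧
    ∃ k : ℝ,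
      ConvexSplit.dMax Ψ
        (ConvexSplit.marginalLeft Ψ ⊗ₖ ConvexSplit.maxMixed (Fin d)) = (k : EReal) ∧
      ConvexSplit.relEntropy (ConvexSplit.tau hup Ψ S)
        (ConvexSplit.marginalLeft Ψ ⊗ₖ
          (ConvexSplit.maxMixed (ZMod g) ⊗ₖ ConvexSplit.maxMixed (ZMod g))) ≤
        ((Real.logb 2 (1 + ((2 : ℝ) ^ (k + 1) - 1) / (S.card : ℝ)) : ℝ) : EReal) ∧
      ConvexSplit.fidelity (ConvexSplit.tau hup Ψ S)
        (ConvexSplit.marginalLeft Ψ ⊗ₖ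
          (ConvexSplit.maxMixed (ZMod g) ⊗ₖ ConvexSplit.maxMixed (ZMod g))) ^ 2 ≥
        1 / (1 + ((2 : ℝ) ^ (k + 1) - 1) / (S.card : ℝ)) := by
  have hne := nonempty_fin_of_le hup
  set ψ := marginalLeft Ψ with hψ
  have hψs : IsState ψ := hΨ.marginalLeft
  set σ := stateRG hup Ψ with hσ
  have hσp : σ.PosSemidef := posSemidef_stateRG hup hΨ.1
  have hσm : marginalLeft σ = ψ := marginalLeft_stateRG hlow hup Ψ
  have hσt : σ.trace = 1 := by
    rw [← hψs.2, ← hσm, Matrix.trace, Matrix.trace, Fintype.sum_prod_type]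
    rfl
  have hμ : IsState (maxMixed (ZMod g)) := isState_maxMixed
  set N := (S.card : ℝ) with hN
  have hN0 : 0 < N := Nat.cast_pos.2 hS.card_pos
  set A := assocKron σ (maxMixed (ZMod g)) with hA
  have hτ : tau hup Ψ S =
      (N⁻¹ : ℝ) • ∑ l ∈ S, A.submatrix (shear R (-l)) (shear R (-l)) := by
    have h1 : ∀ l, tauOne hup Ψ l = A.submatrix (shear R (-l)) (shear R (-l)) := fun l =>
      conj_one_kronecker_U l A
    simp only [tau, h1, ← Complex.coe_smul]
    push_cast [hN]
    rfl
  have hstate : IsState (tau hup Ψ S) := by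
    rw [hτ]
    refine ⟨(Matrix.posSemidef_sum _ fun l _ => ?_).smul (inv_nonneg.2 hN0.le), ?_⟩
    · exact (posSemidef_assocKron hσp hμ.1).submatrix _
    · simp only [Matrix.trace_smul, Matrix.trace_sum, trace_submatrix_perm, hA, trace_assocKron,
        hσt, hμ.2, Finset.sum_const, nsmul_eq_mul, mul_one, Complex.real_smul]
      push_cast [hN]
      exact inv_mul_cancel₀ (Nat.cast_ne_zero.2 hS.card_pos.ne')
  refine ⟨hstate, ?_⟩
  obtain ⟨k, hk, hkle⟩ := exists_dMax_eq hΨ (hψs.kronecker (isState_maxMixed (n := Fin d)))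
    (exists_posSemidef_rpow_smul_sub hΨ.1)
  refine ⟨k, hk, ?_⟩
  have hk0 : (0 : ℝ) < 2 ^ k := Real.rpow_pos_of_pos two_pos k
  obtain ⟨Y, hY, hYt⟩ := exists_factor_of_le hσp (hψs.kronecker hμ).1 (c := 2 * 2 ^ k)
    (by positivity) (posSemidef_smul_sub_stateRG hup hΨ hk0.le hkle)
  set ω := ψ ⊗ₖ (maxMixed (ZMod g) ⊗ₖ maxMixed (ZMod g)) with hω
  have hωp : ω.PosSemidef := (hψs.kronecker (hμ.kronecker hμ)).1
  set B := assocKron Y 1 with hB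
  have hωB : ω * B = A := by
    rw [hω, ← assocKron_kronecker, hB, assocKron_mul, hY, mul_one]
  -- `X` solves `ω X = τ`, as `ω` is invariant under the shears.
  set X := (N⁻¹ : ℝ) • ∑ l ∈ S, B.submatrix (shear R (-l)) (shear R (-l)) with hX
  have hωX : ω * X = tau hup Ψ S := by
    rw [hX, hτ, mul_smul_comm, Finset.mul_sum]
    refine congrArg _ (Finset.sum_congr rfl fun l _ => ?_)
    rw [← hωB, ← Matrix.submatrix_mul_equiv ω B _ (shear R (-l)) _, shear_maxMixed]
  have hdiag : ∀ l : ZMod g, (A.submatrix (shear R (-l)) (shear R (-l)) *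
      B.submatrix (shear R (-l)) (shear R (-l))).trace = (σ * Y).trace := fun l => by
    rw [Matrix.submatrix_mul_equiv, trace_submatrix_perm, hA, hB, assocKron_mul, mul_one,
      trace_assocKron, hμ.2, mul_one]
  have hoff : ∀ l l' : ZMod g, l ≠ l' → (A.submatrix (shear R (-l)) (shear R (-l)) *
      B.submatrix (shear R (-l')) (shear R (-l'))).trace = 1 := fun l l' hl => by
    rw [← trace_submatrix_perm _ (shear R l'), ← Matrix.submatrix_mul_equiv _ _ _ (shear R l') _,
      Matrix.submatrix_submatrix, Matrix.submatrix_submatrix, shear_comp, shear_comp,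
      neg_add_cancel]
    have h0 : (shear R (0 : ZMod g) : R × ZMod g × ZMod g → _) = id := by
      ext1 ⟨r, i, j⟩
      simp [shear_apply]
    rw [h0, Matrix.submatrix_id_id, trace_shear_mul σ Y, hσm, hY, hσt]
    rw [neg_add_eq_sub, sub_ne_zero]
    exact hl.symm
  have hQ : (tau hup Ψ S * X).trace.re ≤ 1 + ((2 : ℝ) ^ (k + 1) - 1) / N := by
    have h1 : (tau hup Ψ S * X).trace.re =
        N⁻¹ * (N⁻¹ * ∑ l ∈ S, ∑ l' ∈ S, if l = l' then (σ * Y).trace.re else 1) := by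
      rw [hτ, hX, smul_mul_assoc, mul_smul_comm, Matrix.trace_smul, Matrix.trace_smul,
        Complex.smul_re, Complex.smul_re, Finset.sum_mul_sum, Matrix.trace_sum, Complex.re_sum]
      simp only [smul_eq_mul]
      refine congrArg _ (congrArg _ (Finset.sum_congr rfl fun l _ => ?_))
      rw [Matrix.trace_sum, Complex.re_sum]
      refine Finset.sum_congr rfl fun l' _ => ?_
      split_ifs with h
      · rw [← h, hdiag]
      · rw [hoff l l' h, Complex.one_re]
    have h2 : ∑ l ∈ S, ∑ l' ∈ S, (if l = l' then (σ * Y).trace.re else 1) =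
        N * ((σ * Y).trace.re - 1 + N) := by
      have h3 : ∀ l l' : ZMod g, (if l = l' then (σ * Y).trace.re else 1) =
          (if l = l' then (σ * Y).trace.re - 1 else 0) + 1 := fun l l' => by
        split_ifs <;> ring
      simp only [h3, Finset.sum_add_distrib, Finset.sum_ite_eq, Finset.sum_const, nsmul_eq_mul,
        Finset.sum_ite_mem, Finset.inter_self, mul_one]
      rw [← hN]
      ring
    rw [hσt, Complex.one_re, mul_one] at hYt
    rw [h1, h2, inv_mul_cancel_left₀ hN0.ne', Real.rpow_add_one two_ne_zero, mul_add,
      inv_mul_cancel₀ hN0.ne', add_comm, div_eq_inv_mul, mul_comm ((2 : ℝ) ^ k)]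
    gcongr
  obtain ⟨hQ0, hD, hF⟩ := relEntropy_le_and_le_fidelity hstate hωp hωX
  refine ⟨hD.trans (EReal.coe_le_coe_iff.2 ?_), (one_div_le_one_div_of_le hQ0 hQ).trans hF⟩
  exact Real.logb_le_logb_of_le one_lt_two hQ0 hQ
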